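/- **Setting.** A structural causal model (SCM) has finitely many endogenous variables $V$, where $A\in V$ has as domain a fixed measurable space $\mathscr D_A$, finitely many mutually independent exogenous variables, and for each $A\in V$ a measurable function $f_A$ of endogenous parents $\mathrm{Pa}_A\subseteq V$ and of a set $U_A$ of exogenous variables, without cycles. A POSCM $M$ is an SCM with a partition $V=O\cup L$ into observed and latent variables. Its causal diagram has the nodes $V$ (marked observed or latent), arrows $B\to A$ for $B\in\mathrm{Pa}_A$, and bi-directed arrows $A\leftrightarrow B$ for $A\ne B$ with $U_A\cap U_B\neq\emptyset$. Write $P(v;M)$ for the law of the endogenous variables and $P(o;M),P(s;M),\dots$ for its marginals. Fix a causal diagram $\mathcal G$, an observed action $X\in O$ and a latent reward $Y\in L$ which is a descendant of $X$ in $\mathcal G$. A policy space $\Pi$ is given by a set of covariates $\mathrm{Pa}(\Pi)\subseteq O$ containing no descendant of $X$ in $\mathcal G_{\overline X}$ ($\mathcal G$ without the arrows into $X$; $X$ counts as a descendant of itself); it consists of all Markov kernels $\pi(x\mid \mathrm{pa}^*)$ from the values of $\mathrm{Pa}(\Pi)$ to the probability distributions on $\mathscr D_X$. $\Pi'$ is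 a subspace of $\Pi$ if $\mathrm{Pa}(\Pi')\subseteq \mathrm{Pa}(\Pi)$; a policy in $\Pi'$ is then regarded as one in $\Pi$ that ignores the other covariates. $P(v\mid \mathrm{do}(\pi);M)$ is the law of the endogenous variables when the value of $X$ is drawn from $\pi(\cdot\mid \mathrm{pa}^*)$ instead of being computed by $f_X$. Let $\mathcal R$ be an arbitrary set of distributions over $O$ (for instance all of them, or the strictly positive ones, which is the usual convention for identifiability). $\mathcal M_{\langle\mathcal G\rangle}$ is the class of all POSCMs $M$ with causal diagram $\mathcal G$ and $P(o;M)\in\mathcal R$, and $\mathcal M_{\langle \mathcal G,P\rangle}=\{M\in\mathcal M_{\langle\mathcal G\rangle}: P(o;M)=P(o)\}$. * For $A\subseteq V$, $P(a\mid\mathrm{do}(\pi))$ is *identifiable* w.r.t. $\langle\mathcal G,\Pi\rangle$ if $P(o;M_1)=P(o;M_2)$ implies $P(a\mid\mathrm{do}(\pi);M_1)=P(a\mid\mathrm{do}(\pi);M_2)$ for all $M_1,M_2\in\mathcal M_{\langle\mathcal G\rangle}$ and all $\pi\in\Pi$. * For $A\subseteq V$, $\pi\in\Pi$ is an *imitating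 policy* for $P(a)$ w.r.t. $\langle\mathcal G,\Pi,P(o)\rangle$ if $P(a\mid\mathrm{do}(\pi);M)=P(a;M)$ for every $M\in\mathcal M_{\langle\mathcal G,P\rangle}$; $P(a)$ is *p-imitable* w.r.t. $\langle\mathcal G,\Pi,P(o)\rangle$ if such a $\pi\in\Pi$ exists (one policy for all these $M$). * $S\subseteq O$ is a *surrogate* w.r.t. $\langle\mathcal G,\Pi'\rangle$ if $S$ d-separates $Y$ from $\hat X$ in the graph obtained from $\mathcal G$ by adding arrows from all nodes in $\mathrm{Pa}(\Pi')$ to $X$ and a new node $\hat X$ with the arrow $\hat X\to X$. * $\langle S,\Pi'\rangle$ is an *instrument* w.r.t. $\langle\mathcal G,\Pi\rangle$ if $\Pi'$ is a subspace of $\Pi$, $S$ is a surrogate w.r.t. $\langle\mathcal G,\Pi'\rangle$, and $P(s\mid\mathrm{do}(\pi))$ is identifiable w.r.t. $\langle\mathcal G,\Pi'\rangle$. **Corollary.** Given $\mathcal G$, a policy space $\Pi$ and an observational distribution $P(o)$, let $\langle S,\Pi'\rangle$ be an instrument w.r.t. $\langle\mathcal G,\Pi\rangle$. If there are a POSCM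 $M\in\mathcal M_{\langle\mathcal G,P\rangle}$ and a policy $\pi\in\Pi'$ such that $P(s\mid\mathrm{do}(\pi);M)=P(s)$, where $P(s)$ is the marginal of $P(o)$ on $S$, then $P(y)$ is p-imitable w.r.t. $\langle\mathcal G,\Pi,P(o)\rangle$. Moreover, $\pi$ is an imitating policy for $P(y)$ w.r.t. $\langle\mathcal G,\Pi,P(o)\rangle$. -/

import Mathlib

open MeasureTheory ProbabilityTheory

universe u v w

noncomputable section

namespace CausalImitation

/-! ### Causal diagrams and d-separation -/

/-- A graph with directed arrows `a → b` (`dir a b`) and bi-directed arrows `a ↔ b` (`bi a b`). -/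
structure MixedGraph (V : Type u) where
  dir : V → V → Prop
  bi : V → V → Prop
  bi_symm : ∀ a b, bi a b → bi b a

namespace MixedGraph

variable {V : Type u}

/-- `De(a)`, the descendants of `a`, with `a` included. -/
def descendants (G : MixedGraph V) (a : V) : Set V := {b | Relation.ReflTransGen G.dir a b}

/-- The subgraph obtained by deleting all arrows that come into `x`. -/
def removeIncoming (G : MixedGraph V) (x : V) : MixedGraph V where
  dir a b := G.dir a b ∧ b ≠ x
  bi a b := G.bi a b ∧ a ≠ x ∧ b ≠ x
  bi_symm a b h := ⟨G.bi_symm a b h.1, h.2.2, h.2.1⟩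

/-- One edge, traversed from `a` to `b`: `a → b`, `a ← b` or `a ↔ b`. -/
inductive Step (G : MixedGraph V) : V → V → Type u
  | fwd {a b : V} (h : G.dir a b) : Step G a b
  | bwd {a b : V} (h : G.dir b a) : Step G a b
  | bidir {a b : V} (h : G.bi a b) : Step G a b

/-- The edge has an arrowhead at the node from which it is traversed. -/
def Step.HeadAtStart {G : MixedGraph V} : {a b : V} → Step G a b → Prop
  | _, _, .fwd _ => False
  | _, _, .bwd _ => True
  | _, _, .bidir _ => True

/-- The edge has an arrowhead at the node to which it is traversed. -/
def Step.HeadAtEnd {G : MixedGraph V} : {a b : V} → Step G a b → Prop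
  | _, _, .fwd _ => True
  | _, _, .bwd _ => False
  | _, _, .bidir _ => True

/-- A sequence of consecutive edges, each traversed in either direction. -/
inductive Walk (G : MixedGraph V) : V → V → Type u
  | nil (a : V) : Walk G a a
  | cons {a b c : V} (e : Step G a b) (p : Walk G b c) : Walk G a c

/-- The nodes of a walk, in order. -/
def Walk.support {G : MixedGraph V} : {a b : V} → Walk G a b → List V
  | _, _, .nil a => [a]
  | a, _, .cons _ p => a :: p.support

/-- A path visits no node more than once. -/
def Walk.IsPath {G : MixedGraph V} {a b : V} (p : Walk G a b) : Prop := p.support.Nodup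

/-- The triple formed by the consecutive edges `e`, `e'`, which meet at `m`, is blocked by `Z`:
either `m` is a collider and neither `m` nor any descendant of `m` is in `Z`, or `m` is the middle
of a chain or a fork and `m ∈ Z`. -/
def BlockedAt (G : MixedGraph V) (Z : Set V) {a m b : V} (e : Step G a m) (e' : Step G m b) :
    Prop :=
  ((e.HeadAtEnd ∧ e'.HeadAtStart) ∧ ∀ z ∈ G.descendants m, z ∉ Z) ∨
    (¬ (e.HeadAtEnd ∧ e'.HeadAtStart) ∧ m ∈ Z)

/-- A walk is blocked by `Z` if one of its triples of consecutive nodes is. -/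
def Walk.Blocked {G : MixedGraph V} (Z : Set V) : {a b : V} → Walk G a b → Prop
  | _, _, .nil _ => False
  | _, _, .cons _ (.nil _) => False
  | _, _, .cons e (.cons e' p) => BlockedAt G Z e e' ∨ Walk.Blocked Z (.cons e' p)

/-- `(A ⫫ B | Z)_G`: every path between a node of `A` and a node of `B` is blocked by `Z`. -/
def DSep (G : MixedGraph V) (A B Z : Set V) : Prop :=
  ∀ a ∈ A, ∀ b ∈ B, ∀ p : Walk G a b, p.IsPath → p.Blocked Z

end MixedGraph

/-- A causal diagram: directed and bi-directed arrows without a directed cycle, together with the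
set `obs` of the observed (solid) nodes. The other nodes are latent (dashed). -/
structure CausalDiagram (V : Type u) extends MixedGraph V where
  obs : Set V
  acyclic : ∀ a, ¬ Relation.TransGen dir a a

/-! ### Structural causal models -/

/-- A (recursive) structural causal model over endogenous variables `V` with domains `D`.
The exogenous variables are indexed by the finite type `J`, they have domains `E j` and are mutually
independent with laws `noise j`. The value of `a : V` is given by the function `f a`, whose
arguments are the endogenous variables in `pa a` and the exogenous variables in `exo a`. -/
structure SCM (V : Type u) (D : V → Type v) [∀ a, MeasurableSpace (D a)] where
  J : Type w
  [fintypeJ : Fintype J]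
  E : J → Type w
  [measurableSpaceE : ∀ j, MeasurableSpace (E j)]
  noise : ∀ j, Measure (E j)
  [isProbabilityMeasure_noise : ∀ j, IsProbabilityMeasure (noise j)]
  pa : V → Set V
  exo : V → Set J
  f : ∀ a, (∀ b : pa a, D b) → (∀ j : exo a, E j) → D a
  measurable_f : ∀ a, Measurable fun z : (∀ b : pa a, D b) × (∀ j : exo a, E j) => f a z.1 z.2
  acyclic : ∀ a, ¬ Relation.TransGen (fun b c => b ∈ pa c) a a

attribute [instance] SCM.fintypeJ SCM.measurableSpaceE SCM.isProbabilityMeasure_noise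

/-- A partially observable SCM: the endogenous variables are split into the observed ones, `obs`,
and the latent ones, `obsᶜ`. -/
structure POSCM (V : Type u) (D : V → Type v) [∀ a, MeasurableSpace (D a)] extends
    SCM.{u, v, w} V D where
  obs : Set V

namespace SCM

variable {V : Type u} {D : V → Type v} [∀ a, MeasurableSpace (D a)]

/-- The space of values of all the exogenous variables. -/
abbrev Exo (M : SCM.{u, v, w} V D) : Type w := ∀ j, M.E j

/-- The exogenous distribution `P(u)`. -/
def exoLaw (M : SCM.{u, v, w} V D) : Measure M.Exo := Measure.pi M.noise

instance (M : SCM.{u, v, w} V D) : IsProbabilityMeasure M.exoLaw := by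
  unfold exoLaw; infer_instance

theorem wellFounded [Finite V] (M : SCM.{u, v, w} V D) :
    WellFounded fun b a : V => b ∈ M.pa a := by
  have : IsTrans V (Relation.TransGen fun b a : V => b ∈ M.pa a) := ⟨fun _ _ _ h h' => h.trans h'⟩
  have : Std.Irrefl (Relation.TransGen fun b a : V => b ∈ M.pa a) := ⟨M.acyclic⟩
  have h := Finite.wellFounded_of_trans_of_irrefl (Relation.TransGen fun b a : V => b ∈ M.pa a)
  exact ⟨fun a => Subrelation.accessible (r := Relation.TransGen fun b a : V => b ∈ M.pa a)
    (fun h => Relation.TransGen.single h) (h.apply a)⟩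

/-- The values of the endogenous variables in the exogenous state `s`, when every variable `a` with
`c a = some x` is set to the constant `x`, in place of the value of its structural function. -/
def solve [Finite V] (M : SCM.{u, v, w} V D) (c : ∀ a, Option (D a)) (s : M.Exo) : ∀ a, D a :=
  M.wellFounded.fix fun a ih =>
    (c a).getD (M.f a (fun b => ih b.1 b.2) (fun j => s j.1))

theorem solve_eq [Finite V] (M : SCM.{u, v, w} V D) (c : ∀ a, Option (D a)) (s : M.Exo) (a : V) :
    M.solve c s a = (c a).getD (M.f a (fun b => M.solve c s b.1) (fun j => s j.1)) := by
  unfold solve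
  rw [WellFounded.fix_eq]

/-- No intervention. -/
def noAct : ∀ a : V, Option (D a) := fun _ => none

open Classical in
/-- The atomic intervention `do(X = x)`. -/
def act (X : V) (x : D X) : ∀ a : V, Option (D a) := Function.update noAct X (some x)

theorem measurable_solve_aux [Finite V] (M : SCM.{u, v, w} V D) {Z : Type*} [MeasurableSpace Z]
    (c : Z → ∀ a, Option (D a)) (s : Z → M.Exo) (hs : Measurable s)
    (hc : ∀ a, (∀ z, c z a = none) ∨ ∃ g : Z → D a, Measurable g ∧ ∀ z, c z a = some (g z)) :
    Measurable fun z => M.solve (c z) (s z) := by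
  refine measurable_pi_lambda _ fun a => ?_
  induction a using M.wellFounded.induction with
  | _ a ih =>
    rcases hc a with h | ⟨g, hg, h⟩
    · have : (fun z => M.solve (c z) (s z) a) =
          fun z => M.f a (fun b => M.solve (c z) (s z) b.1) (fun j => s z j.1) := by
        funext z
        rw [solve_eq, h z]
        rfl
      rw [this]
      refine (M.measurable_f a).comp (Measurable.prodMk ?_ ?_)
      · exact measurable_pi_lambda _ fun b => ih b.1 b.2
      · exact measurable_pi_lambda _ fun j => (measurable_pi_apply j.1).comp hs
    · have : (fun z => M.solve (c z) (s z) a) = g := by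
        funext z
        rw [solve_eq, h z]
        rfl
      rw [this]
      exact hg

theorem measurable_solve_noAct [Finite V] (M : SCM.{u, v, w} V D) :
    Measurable fun s : M.Exo => M.solve noAct s :=
  M.measurable_solve_aux (fun _ => noAct) id measurable_id fun _ => Or.inl fun _ => rfl

theorem measurable_solve_act [Finite V] (M : SCM.{u, v, w} V D) (X : V) :
    Measurable fun z : M.Exo × D X => M.solve (act X z.2) z.1 := by
  refine M.measurable_solve_aux (fun z => act X z.2) Prod.fst measurable_fst fun a => ?_
  by_cases h : a = X
  · subst h
    exact Or.inr ⟨Prod.snd, measurable_snd, fun z => by simp [act]⟩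
  · exact Or.inl fun z => by simp [act, noAct, h]

/-- The atomic intervention `do(X = x)` does not change the values of the non-descendants of `X`. -/
theorem solve_act_of_not_descendant [Finite V] (M : SCM.{u, v, w} V D) (X : V) (x : D X)
    (s : M.Exo) (a : V) (ha : ¬ Relation.ReflTransGen (fun b c => b ∈ M.pa c) X a) :
    M.solve (act X x) s a = M.solve noAct s a := by
  induction a using M.wellFounded.induction with
  | _ a ih =>
    have hne : a ≠ X := by
      rintro rfl
      exact ha .refl
    rw [solve_eq, solve_eq]
    have h1 : act X x a = none := by simp [act, noAct, hne]
    have h2 : (fun b : M.pa a => M.solve (act X x) s b.1) =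
        fun b : M.pa a => M.solve noAct s b.1 := by
      funext b
      exact ih b.1 b.2 fun h => ha (h.tail b.2)
    rw [h1, h2]
    rfl

/-- The distribution `P(v; M)` over the endogenous variables. -/
def law [Finite V] (M : SCM.{u, v, w} V D) : Measure (∀ a, D a) :=
  M.exoLaw.map (M.solve noAct)

/-- The interventional distribution `P(v | do(π); M)`: the exogenous variables are drawn from
`P(u)`, then `x` is drawn from `π(· | pa*)`, where `pa*` are the values of the covariates in `C`,
and every other endogenous variable takes the value that its own structural function gives it when
`X` is `x`. The covariates are non-descendants of `X`, so that their values are fixed before the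
action is drawn and do not depend on it (`solve_act_of_not_descendant`). -/
def doLaw [Finite V] (M : SCM.{u, v, w} V D) {X : V} {C : Set V}
    (π : Kernel (∀ a : C, D a) (D X)) : Measure (∀ a, D a) :=
  (M.exoLaw.compProd
    (π.comap (fun s => C.domRestrict (M.solve noAct s))
      ((Set.measurable_restrict C).comp M.measurable_solve_noAct))).map
    fun z => M.solve (act X z.2) z.1

end SCM

/-- The marginal `P(a)` of a distribution `P(v)` over all the endogenous variables. -/
def marginal {V : Type u} {D : V → Type v} [∀ a, MeasurableSpace (D a)]
    (μ : Measure (∀ a, D a)) (A : Set V) : Measure (∀ a : A, D a) :=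
  μ.map A.domRestrict

namespace POSCM

variable {V : Type u} {D : V → Type v} [∀ a, MeasurableSpace (D a)]

/-- The causal diagram of a POSCM: arrows into `b` come from the arguments of its function, and
`a ↔ b` if the functions of `a` and `b` share an exogenous variable. -/
def diagram (M : POSCM.{u, v, w} V D) : CausalDiagram V where
  dir a b := a ∈ M.pa b
  bi a b := a ≠ b ∧ (M.exo a ∩ M.exo b).Nonempty
  bi_symm _ _ h := ⟨h.1.symm, by rw [Set.inter_comm]; exact h.2⟩
  obs := M.obs
  acyclic := M.acyclic

end POSCM

/-! ### Policies, identifiability, imitation -/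

section Imitation

variable {V : Type u} [Finite V] {D : V → Type v} [∀ a, MeasurableSpace (D a)]

/-- A policy space over the action `X`, given by its set of covariates: observed variables which are
not descendants of `X` in the diagram without the arrows into `X`. -/
structure PolicySpace (G : CausalDiagram V) (X : V) where
  cov : Set V
  cov_subset : cov ⊆ G.obs \ (G.removeIncoming X).descendants X

/-- The policies in a policy space: (measurable) maps from values of the covariates to probability
distributions over the domain of `X`. -/
structure Policy {G : CausalDiagram V} {X : V} (Pol : PolicySpace G X) (D : V → Type v)
    [∀ a, MeasurableSpace (D a)] where
  kernel : Kernel (∀ a : Pol.cov, D a) (D X)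
  [isMarkovKernel : IsMarkovKernel kernel]

attribute [instance] Policy.isMarkovKernel

/-- `Pol'` is a subspace of `Pol`. -/
def PolicySpace.IsSubspace {G : CausalDiagram V} {X : V} (Pol' Pol : PolicySpace G X) : Prop :=
  Pol'.cov ⊆ Pol.cov

/-- A policy in a subspace, as a policy in the larger space which ignores the other covariates. -/
def Policy.lift {G : CausalDiagram V} {X : V} {Pol' Pol : PolicySpace G X}
    (h : Pol'.IsSubspace Pol) (π : Policy Pol' D) : Policy Pol D where
  kernel := π.kernel.comap (Set.domRestrict₂ h) (Set.measurable_restrict₂ h)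
  isMarkovKernel := ProbabilityTheory.Kernel.IsMarkovKernel.comap _ _

/-- The class of all the POSCMs that are compatible with `G` and whose observational distribution
lies in `R`. Here `R` is the set of the observational distributions that are taken into account:
`Set.univ` for no restriction, or for instance the strictly positive distributions. -/
def modelClass (G : CausalDiagram V) (R : Set (Measure (∀ a : G.obs, D a))) :
    Set (POSCM.{u, v, w} V D) :=
  {M | M.diagram = G ∧ marginal M.law G.obs ∈ R}

/-- The models in `modelClass G R` with observational distribution `P(o; M) = P(o)`. -/
def modelClassOf (G : CausalDiagram V) (R : Set (Measure (∀ a : G.obs, D a)))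
    (P : Measure (∀ a : G.obs, D a)) : Set (POSCM.{u, v, w} V D) :=
  {M | M ∈ modelClass.{u, v, w} G R ∧ marginal M.law G.obs = P}

variable {G : CausalDiagram V} {X : V}

/-- `P(a | do(π))` is identifiable w.r.t. the diagram and the policy space: in the class of models,
it is determined by `P(o; M)` and the policy `π`. -/
def Identifiable (R : Set (Measure (∀ a : G.obs, D a))) (Pol : PolicySpace G X) (A : Set V) :
    Prop :=
  ∀ M₁ ∈ modelClass.{u, v, w} G R, ∀ M₂ ∈ modelClass.{u, v, w} G R,
    marginal M₁.law G.obs = marginal M₂.law G.obs →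
      ∀ π : Policy Pol D, marginal (M₁.doLaw π.kernel) A = marginal (M₂.doLaw π.kernel) A

/-- The policy `π` is an imitating policy for `P(a)` w.r.t. the diagram, the policy space and the
observational distribution `P(o)`. -/
def IsImitating (R : Set (Measure (∀ a : G.obs, D a))) (P : Measure (∀ a : G.obs, D a))
    (A : Set V) {Pol : PolicySpace G X} (π : Policy Pol D) : Prop :=
  ∀ M ∈ modelClassOf.{u, v, w} G R P, marginal (M.doLaw π.kernel) A = marginal M.law A

/-- `P(a)` is practically imitable w.r.t. the diagram, the policy space and `P(o)`: one policy,
which depends on the model only through `P(o)`, imitates `P(a)` in all the models with this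
observational distribution. -/
def PImitable (R : Set (Measure (∀ a : G.obs, D a))) (Pol : PolicySpace G X)
    (P : Measure (∀ a : G.obs, D a)) (A : Set V) : Prop :=
  ∃ π : Policy Pol D, IsImitating.{u, v, w} R P A π

/-- The supergraph of `G` with additional arrows from the covariates of the policy space to `X`,
and with a new parent `X̂` of `X`. The new node is `none`. -/
def augmented (Pol : PolicySpace G X) : MixedGraph (Option V) where
  dir
    | some a, some b => G.dir a b ∨ (a ∈ Pol.cov ∧ b = X)
    | none, some b => b = X
    | _, none => False
  bi
    | some a, some b => G.bi a b
    | _, _ => False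
  bi_symm
    | some a, some b => G.bi_symm a b
    | none, none => id
    | none, some _ => id
    | some _, none => id

/-- `S` is an imitation surrogate for the reward `Y`: `S ⊆ O` and `(Y ⫫ X̂ | S)` holds in the
augmented graph. -/
def IsSurrogate (Pol : PolicySpace G X) (Y : V) (S : Set V) : Prop :=
  S ⊆ G.obs ∧ (augmented Pol).DSep {some Y} {none} (some '' S)

variable (D) in
/-- `⟨S, Pol'⟩` is an imitation instrument: `Pol'` is a subspace of `Pol`, the set `S` is a surrogate
w.r.t. `Pol'`, and `P(s | do(π))` is identifiable w.r.t. `Pol'`. -/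
structure IsInstrument (R : Set (Measure (∀ a : G.obs, D a))) (Y : V) (Pol : PolicySpace G X)
    (S : Set V) (Pol' : PolicySpace G X) : Prop where
  subspace : Pol'.IsSubspace Pol
  surrogate : IsSurrogate Pol' Y S
  identifiable : Identifiable.{u, v, w} R Pol' S

end Imitation

end CausalImitation

end

open CausalImitation

/-!
Let `M` be a model with the given observational distribution. By identifiability, the policy `π`
gives the surrogate `S` its observational law in `M` as well, so it remains to be shown that the
reward `Y` then also has its observational law (`marginal_doLaw_eq_of_surrogate`).

Add to the model a switch `X̂`, which decides whether the action is drawn from `π` or takes its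
natural value (`SCM.switchLaw`). The d-separation of `Y` from `X̂` given `S` makes `Y` and the switch
conditionally independent given `S`, so that both positions of the switch have the same conditional
expectations of functions of `Y` given `S`. Since the law of `S` is also the same in both positions,
so is that of `Y`.

Only this instance of the global Markov property is needed, and it has a direct proof. Call two
ancestors of `S ∪ {Y}` linked if they are joined by a bi-directed arrow or by an arrow that does not
come out of `S`. A chain of links from `Y` to `X̂` would yield an unblocked path
(`MixedGraph.DSep.not_linked`). Hence the mechanisms of the ancestors of `S ∪ {Y}` split into a part
`F₁`, which contains that of the action, and a part `F₂`, which contains that of `Y`, such that the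
parts use disjoint sets of exogenous variables and see each other only through values in `S`
(`IsSurrogate.exists_split`). The exogenous variables of the two parts are independent. Now reveal
the values of `S` in a topological order: each of them is a function of the revealed values and of
the randomness of one part, so by the weak union property the two parts remain conditionally
independent given what has been revealed (`condIndepGiven_switchLaw`).

The domains are arbitrary measurable spaces, so that neither regular conditional distributions nor a
representation of `π` by an exogenous variable are available. Conditional independence is therefore
expressed by conditional expectations (`CondIndepGiven`), and the draw of the action is adjoined to
the part `F₁` when its turn comes (`CondIndepGiven.sup_comap_snd`).
-/

namespace CausalImitation

open scoped ENNReal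

/-! ### Unblocked paths -/

namespace MixedGraph

variable {V : Type u}

/-- `An(A)`, the ancestors of the nodes of `A`, with `A` included. -/
def ancestors (G : MixedGraph V) (A : Set V) : Set V :=
  {a | ∃ z ∈ A, Relation.ReflTransGen G.dir a z}

theorem subset_ancestors (G : MixedGraph V) (A : Set V) : A ⊆ G.ancestors A :=
  fun a ha => ⟨a, ha, .refl⟩

theorem mem_ancestors_of_dir {G : MixedGraph V} {A : Set V} {a b : V} (h : G.dir a b)
    (hb : b ∈ G.ancestors A) : a ∈ G.ancestors A :=
  let ⟨z, hz, hbz⟩ := hb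
  ⟨z, hz, hbz.head h⟩

/-- An edge, traversed from `a` to `b`, that may extend an unblocked path: it does not come out of a
node of `Z`, and if `b` is not an ancestor of `Z`, it has no arrowhead at `b`, so that `b` will not
be a collider. The condition involves a single edge, and yet two consecutive edges that satisfy it
never form a blocked triple (`not_blockedAt_of_isOpen`). -/
def Step.IsOpen {G : MixedGraph V} (Z : Set V) {a b : V} (e : Step G a b) : Prop :=
  (¬ e.HeadAtEnd → b ∉ Z) ∧ (¬ e.HeadAtStart → a ∉ Z) ∧
    (b ∉ G.ancestors Z → ¬ e.HeadAtEnd)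

theorem not_blockedAt_of_isOpen {G : MixedGraph V} {Z : Set V} {a m b : V} {e : Step G a m}
    {e' : Step G m b} (he : e.IsOpen Z) (he' : e'.IsOpen Z) : ¬ BlockedAt G Z e e' := by
  rintro (⟨⟨h1, -⟩, h3⟩ | ⟨h1, hm⟩)
  · exact he.2.2 (fun ⟨z, hz, hmz⟩ => h3 z hmz hz) h1
  · exact h1 ⟨by_contra fun h => he.1 h hm, by_contra fun h => he'.2.1 h hm⟩

/-- All the edges of the walk are open. -/
def Walk.IsOpen {G : MixedGraph V} (Z : Set V) : {a b : V} → Walk G a b → Prop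
  | _, _, .nil _ => True
  | _, _, .cons e p => e.IsOpen Z ∧ p.IsOpen Z

theorem Walk.IsOpen.not_blocked {G : MixedGraph V} {Z : Set V} {a b : V} {p : Walk G a b}
    (hp : p.IsOpen Z) : ¬ p.Blocked Z := by
  induction p with
  | nil a => exact id
  | cons e p ih =>
    cases p with
    | nil => exact id
    | cons e' p =>
      rintro (h | h)
      · exact not_blockedAt_of_isOpen hp.1 hp.2.1 h
      · exact ih hp.2 h

theorem Walk.IsOpen.exists_suffix {G : MixedGraph V} {Z : Set V} {a b c : V} {p : Walk G a b}
    (hp : p.IsOpen Z) (hpath : p.IsPath) (hc : c ∈ p.support) :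
    ∃ q : Walk G c b, q.IsOpen Z ∧ q.IsPath := by
  induction p with
  | nil a =>
    obtain rfl : c = a := by simpa [Walk.support] using hc
    exact ⟨.nil c, trivial, hpath⟩
  | @cons a a' b e p ih =>
    by_cases h : c = a
    · subst h
      exact ⟨.cons e p, hp, hpath⟩
    · refine ih hp.2 (List.nodup_cons.1 hpath).2 ?_
      simpa [Walk.support, h] using hc

/-- Open walks can be shortened to open paths, since openness is a condition on single edges. -/
theorem Walk.IsOpen.exists_isPath {G : MixedGraph V} {Z : Set V} {a b : V} {p : Walk G a b}
    (hp : p.IsOpen Z) : ∃ q : Walk G a b, q.IsOpen Z ∧ q.IsPath := by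
  induction p with
  | nil a => exact ⟨.nil a, trivial, by simp [Walk.IsPath, Walk.support]⟩
  | @cons a a' b e p ih =>
    obtain ⟨q, hq, hq'⟩ := ih hp.2
    by_cases h : a ∈ q.support
    · exact hq.exists_suffix hq' h
    · exact ⟨.cons e q, ⟨hp.1, hq⟩, List.nodup_cons.2 ⟨h, hq'⟩⟩

theorem Walk.IsOpen.exists_concat {G : MixedGraph V} {Z : Set V} {a b c : V} {p : Walk G a b}
    (hp : p.IsOpen Z) {e : Step G b c} (he : e.IsOpen Z) : ∃ q : Walk G a c, q.IsOpen Z := by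
  induction p with
  | nil a => exact ⟨.cons e (.nil _), he, trivial⟩
  | cons e' p ih =>
    obtain ⟨q, hq⟩ := ih hp.2 he
    exact ⟨.cons e' q, hp.1, hq⟩

/-- Two nodes of `W` are linked given `Z` if they are joined by a bi-directed arrow, or by an arrow
which does not come out of `Z`. In a structural causal model, the mechanisms of linked nodes share
an exogenous variable or an endogenous variable outside `Z`. -/
def Linked (G : MixedGraph V) (W Z : Set V) (a b : V) : Prop :=
  a ∈ W ∧ b ∈ W ∧ (G.bi a b ∨ (G.dir a b ∧ a ∉ Z) ∨ (G.dir b a ∧ b ∉ Z))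

theorem Linked.symm {G : MixedGraph V} {W Z : Set V} {a b : V} (h : G.Linked W Z a b) :
    G.Linked W Z b a :=
  ⟨h.2.1, h.1, h.2.2.elim (fun h => .inl (G.bi_symm _ _ h)) fun h => .inr h.symm⟩

/-- A chain of links between ancestors of `Z ∪ {y}` which starts at `y` yields an unblocked path.
Ancestors of `Z` are reached along the chain, and the other nodes are reached from `y` by a directed
path traversed backwards. -/
theorem exists_isOpen_of_linked {G : MixedGraph V} {Z : Set V} {y b : V}
    (h : Relation.ReflTransGen (G.Linked (G.ancestors (insert y Z)) Z) y b) :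
    ∃ p : Walk G y b, p.IsOpen Z := by
  have key : ∀ b, Relation.ReflTransGen G.dir b y → b ∉ G.ancestors Z →
      ∃ p : Walk G y b, p.IsOpen Z := by
    intro b hb
    induction hb using Relation.ReflTransGen.head_induction_on with
    | refl => exact fun _ => ⟨.nil y, trivial⟩
    | @head b c hbc _ ih =>
      intro hbZ
      obtain ⟨p, hp⟩ := ih fun hc => hbZ (mem_ancestors_of_dir hbc hc)
      exact hp.exists_concat (e := .bwd hbc)
        ⟨fun _ h => hbZ (G.subset_ancestors Z h), fun h => absurd trivial h, fun _ => id⟩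
  induction h with
  | refl => exact ⟨.nil y, trivial⟩
  | @tail b c _ hbc ih =>
    by_cases hcZ : c ∈ G.ancestors Z
    · obtain ⟨p, hp⟩ := ih
      obtain h | ⟨h, hb⟩ | ⟨h, hc⟩ := hbc.2.2
      · exact hp.exists_concat (e := .bidir h)
          ⟨fun h => absurd trivial h, fun h => absurd trivial h, fun h => absurd hcZ h⟩
      · exact hp.exists_concat (e := .fwd h)
          ⟨fun h => absurd trivial h, fun _ => hb, fun h => absurd hcZ h⟩
      · exact hp.exists_concat (e := .bwd h)
          ⟨fun _ => hc, fun h => absurd trivial h, fun h => absurd hcZ h⟩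
    · obtain ⟨z, rfl | hz, hcz⟩ := hbc.2.1
      · exact key c hcz hcZ
      · exact absurd ⟨z, hz, hcz⟩ hcZ

/-- A d-separated pair is not linked by a chain of ancestors. -/
theorem DSep.not_linked {G : MixedGraph V} {Z : Set V} {y r : V} (h : G.DSep {y} {r} Z) :
    ¬ Relation.ReflTransGen (G.Linked (G.ancestors (insert y Z)) Z) y r := by
  intro hl
  obtain ⟨p, hp⟩ := exists_isOpen_of_linked hl
  obtain ⟨q, hq, hq'⟩ := hp.exists_isPath
  exact hq.not_blocked (h y rfl r rfl q hq')

end MixedGraph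

/-! ### Splitting the causal diagram -/

section Diagram

variable {V : Type u} {G : CausalDiagram V} {X : V}

/-- The arrows of `G` together with those from the covariates of the policy space to `X`. -/
def policyDir (Pol : PolicySpace G X) (a b : V) : Prop := G.dir a b ∨ (a ∈ Pol.cov ∧ b = X)

theorem PolicySpace.not_descendant (Pol : PolicySpace G X) {c : V} (hc : c ∈ Pol.cov) :
    ¬ Relation.ReflTransGen G.dir X c := by
  intro h
  refine (Pol.cov_subset hc).2 ?_
  -- A directed path from `X` does not come back to `X`, so it survives the deletion of arrows.
  induction h with
  | refl => exact .refl
  | @tail b d hXb hbd ih =>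
    have hd : d ≠ X := by
      rintro rfl
      exact G.acyclic d (Relation.TransGen.tail' hXb hbd)
    clear hc
    have hX : Relation.ReflTransGen (G.removeIncoming X).dir X b := by
      clear ih hd hbd
      induction hXb with
      | refl => exact .refl
      | @tail b d hXb hbd ih =>
        refine ih.tail ⟨hbd, ?_⟩
        rintro rfl
        exact G.acyclic d (Relation.TransGen.tail' hXb hbd)
    exact hX.tail ⟨hbd, hd⟩

theorem policyDir_acyclic (Pol : PolicySpace G X) (a : V) :
    ¬ Relation.TransGen (policyDir Pol) a a := by
  -- A directed path uses the new arrows at most once, since no covariate descends from `X`.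
  have key : ∀ b, Relation.TransGen (policyDir Pol) a b → Relation.TransGen G.dir a b ∨
      ∃ c ∈ Pol.cov, Relation.ReflTransGen G.dir a c ∧ Relation.ReflTransGen G.dir X b := by
    intro b h
    induction h with
    | single h =>
      obtain h | ⟨h, rfl⟩ := h
      · exact .inl (.single h)
      · exact .inr ⟨a, h, .refl, .refl⟩
    | @tail b d _ hbd ih =>
      obtain h | ⟨hb, rfl⟩ := hbd
      · obtain ih | ⟨c, hc, hac, hXb⟩ := ih
        · exact .inl (ih.tail h)
        · exact .inr ⟨c, hc, hac, hXb.tail h⟩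
      · obtain ih | ⟨c, hc, hac, hXb⟩ := ih
        · exact .inr ⟨b, hb, ih.to_reflTransGen, .refl⟩
        · exact absurd hXb (Pol.not_descendant hb)
  intro h
  obtain h | ⟨c, hc, hac, hXa⟩ := key a h
  · exact G.acyclic a h
  · exact Pol.not_descendant hc (hXa.trans hac)

theorem policyDir_wellFounded [Finite V] (Pol : PolicySpace G X) :
    WellFounded (policyDir Pol) := by
  have : IsTrans V (Relation.TransGen (policyDir Pol)) := ⟨fun _ _ _ h h' => h.trans h'⟩
  have : Std.Irrefl (Relation.TransGen (policyDir Pol)) := ⟨policyDir_acyclic Pol⟩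
  exact Subrelation.wf (fun h => Relation.TransGen.single h)
    (Finite.wellFounded_of_trans_of_irrefl (Relation.TransGen (policyDir Pol)))

/-- If `S` is a surrogate, then the mechanisms of the ancestors of `S ∪ {Y}` split into a part `F₁`,
which contains that of the action, and a part `F₂`, which contains that of the reward, such that
the two parts have no exogenous variable in common and communicate only through `S`. -/
theorem IsSurrogate.exists_split {Pol : PolicySpace G X} {Y : V} {S : Set V}
    (h : IsSurrogate Pol Y S) (hXY : Y ∈ G.descendants X) :
    ∃ F₁ F₂ : Set V, X ∈ F₁ ∧ Y ∈ F₂ ∧ S ⊆ F₁ ∪ F₂ ∧ Disjoint F₁ F₂ ∧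
      (∀ a ∈ F₁, ∀ b, policyDir Pol b a → b ∈ F₁ ∪ S) ∧
      (∀ a ∈ F₂, ∀ b, policyDir Pol b a → b ∈ F₂ ∪ S) ∧
      ∀ a ∈ F₁, ∀ b ∈ F₂, ¬ G.bi a b := by
  set H := augmented Pol
  set Z : Set (Option V) := some '' S with hZ
  set W := H.ancestors (insert (some Y) Z)
  have hdir : ∀ {a b : V}, policyDir Pol a b → H.dir (some a) (some b) := fun h => h
  have hXW : some X ∈ W := by
    refine ⟨some Y, .inl rfl, ?_⟩
    exact Relation.ReflTransGen.lift some (fun a b hab => hdir (.inl hab)) _ _ hXY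
  have hrX : H.dir none (some X) := rfl
  have hrW : none ∈ W := MixedGraph.mem_ancestors_of_dir hrX hXW
  set F : Set (Option V) := {a | Relation.ReflTransGen (H.Linked W Z) none a}
  have hFW : ∀ {a}, a ∈ F → a ∈ W := by
    intro a ha
    obtain rfl | ⟨c, -, hc⟩ := Relation.ReflTransGen.cases_tail ha
    · exact hrW
    · exact hc.2.1
  have : Std.Symm (H.Linked W Z) := ⟨fun _ _ h => h.symm⟩
  have hYF : some Y ∉ F := fun hY => h.2.not_linked (Std.Symm.symm _ _ hY)
  refine ⟨some ⁻¹' F, some ⁻¹' (W \ F), ?_, ⟨⟨some Y, .inl rfl, .refl⟩, hYF⟩, ?_, ?_, ?_, ?_, ?_⟩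
  · exact Relation.ReflTransGen.single ⟨hrW, hXW, .inr (.inl ⟨hrX, by simp [hZ]⟩)⟩
  · intro s hs
    by_cases hsF : some s ∈ F
    · exact .inl hsF
    · exact .inr ⟨H.subset_ancestors _ (.inr ⟨s, hs, rfl⟩), hsF⟩
  · exact Set.disjoint_left.2 fun a ha ha' => ha'.2 ha
  · intro a ha b hba
    by_cases hb : b ∈ S
    · exact .inr hb
    refine .inl (Relation.ReflTransGen.tail ha ⟨hFW ha,
      MixedGraph.mem_ancestors_of_dir (hdir hba) (hFW ha), .inr (.inr ⟨hdir hba, ?_⟩)⟩)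
    rintro ⟨c, hc, hcb⟩
    exact hb (Option.some_injective _ hcb ▸ hc)
  · intro a ha b hba
    by_cases hb : b ∈ S
    · exact .inr hb
    have hbW : some b ∈ W := MixedGraph.mem_ancestors_of_dir (hdir hba) ha.1
    refine .inl ⟨hbW, fun hbF => ha.2 ?_⟩
    refine Relation.ReflTransGen.tail hbF ⟨hbW, ha.1, .inr (.inl ⟨hdir hba, ?_⟩)⟩
    rintro ⟨c, hc, hcb⟩
    exact hb (Option.some_injective _ hcb ▸ hc)
  · intro a ha b hb hab
    exact hb.2 (Relation.ReflTransGen.tail ha ⟨hFW ha, hb.1, .inl hab⟩)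

end Diagram

/-- Induction along a topological order: a property of sets of nodes holds for the whole node set if
it holds for `∅` and carries over when a node all of whose predecessors are present is added to a
set closed under predecessors. -/
theorem set_induction_of_wellFounded {V : Type u} [Finite V] {r : V → V → Prop} (hr : WellFounded r)
    {p : Set V → Prop} (empty : p ∅)
    (insert : ∀ (K : Set V) (a : V), (∀ b ∈ K, ∀ c, r c b → c ∈ K) → a ∉ K →
      (∀ c, r c a → c ∈ K) → p K → p (insert a K)) : p Set.univ := by
  obtain ⟨K, hK⟩ := (Set.toFinite {K : Set V | (∀ b ∈ K, ∀ c, r c b → c ∈ K) ∧ p K}).exists_maximal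
    ⟨∅, by simp, empty⟩
  by_contra hp
  have hne : Kᶜ.Nonempty := by
    rw [Set.nonempty_compl]
    rintro rfl
    exact hp hK.prop.2
  have ha := hr.min_mem Kᶜ hne
  have hmin : ∀ c, r c (hr.min Kᶜ hne) → c ∈ K := fun c hc => by
    by_contra hcK
    exact hr.not_lt_min Kᶜ hcK hc
  refine ha (hK.le_of_ge (y := Insert.insert (hr.min Kᶜ hne) K) ⟨?_, ?_⟩ (Set.subset_insert _ _)
    (Set.mem_insert _ _))
  · rintro b (rfl | hb) c hc
    · exact .inr (hmin c hc)
    · exact .inr (hK.prop.1 b hb c hc)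
  · exact insert K _ hK.prop.1 ha hmin hK.prop.2

/-! ### Conditional independence of σ-algebras -/

/-- The integrals over the sets of `m₁ ⊔ m₂` are determined by those over the sets `s ∩ t` with
`s` in `m₁` and `t` in `m₂`. -/
theorem setLIntegral_eq_of_sup {Ω : Type*} {m₁ m₂ mΩ : MeasurableSpace Ω}
    {μ : Measure Ω} (h₁ : m₁ ≤ mΩ) (h₂ : m₂ ≤ mΩ) {f g : Ω → ℝ≥0∞}
    (hf : ∫⁻ ω, f ω ∂μ ≠ ∞)
    (h : ∀ s, MeasurableSet[m₁] s → ∀ t, MeasurableSet[m₂] t →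
      ∫⁻ ω in s ∩ t, f ω ∂μ = ∫⁻ ω in s ∩ t, g ω ∂μ)
    {t : Set Ω} (ht : MeasurableSet[m₁ ⊔ m₂] t) : ∫⁻ ω in t, f ω ∂μ = ∫⁻ ω in t, g ω ∂μ := by
  have hle : m₁ ⊔ m₂ ≤ mΩ := sup_le h₁ h₂
  have := isFiniteMeasure_withDensity hf
  have huniv := h Set.univ (@MeasurableSet.univ _ m₁) Set.univ (@MeasurableSet.univ _ m₂)
  have htrim : (μ.withDensity f).trim hle = (μ.withDensity g).trim hle := by
    refine @ext_of_generate_finite Ω (m₁ ⊔ m₂) _ _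
      {r | ∃ s t, MeasurableSet[m₁] s ∧ MeasurableSet[m₂] t ∧ r = s ∩ t} ?_ ?_ ?_ ?_ ?_
    · refine le_antisymm (sup_le ?_ ?_) (MeasurableSpace.generateFrom_le ?_)
      · exact fun s hs => MeasurableSpace.measurableSet_generateFrom
          ⟨s, Set.univ, hs, @MeasurableSet.univ _ m₂, by simp⟩
      · exact fun t ht => MeasurableSpace.measurableSet_generateFrom
          ⟨Set.univ, t, @MeasurableSet.univ _ m₁, ht, by simp⟩
      · rintro _ ⟨s, t, hs, ht, rfl⟩
        exact @MeasurableSet.inter _ (m₁ ⊔ m₂) _ _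
          ((le_sup_left : m₁ ≤ m₁ ⊔ m₂) _ hs) ((le_sup_right : m₂ ≤ m₁ ⊔ m₂) _ ht)
    · rintro _ ⟨s, t, hs, ht, rfl⟩ _ ⟨s', t', hs', ht', rfl⟩ -
      exact ⟨s ∩ s', t ∩ t', @MeasurableSet.inter _ m₁ _ _ hs hs',
        @MeasurableSet.inter _ m₂ _ _ ht ht', Set.inter_inter_inter_comm _ _ _ _⟩
    · exact isFiniteMeasure_trim hle
    · rintro _ ⟨s, t, hs, ht, rfl⟩
      have hst : MeasurableSet[m₁ ⊔ m₂] (s ∩ t) := @MeasurableSet.inter _ (m₁ ⊔ m₂) _ _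
          ((le_sup_left : m₁ ≤ m₁ ⊔ m₂) _ hs) ((le_sup_right : m₂ ≤ m₁ ⊔ m₂) _ ht)
      rw [trim_measurableSet_eq hle hst, trim_measurableSet_eq hle hst,
        withDensity_apply _ (hle _ hst), withDensity_apply _ (hle _ hst), h s hs t ht]
    · rw [trim_measurableSet_eq hle (@MeasurableSet.univ _ (m₁ ⊔ m₂)),
        trim_measurableSet_eq hle (@MeasurableSet.univ _ (m₁ ⊔ m₂)),
        withDensity_apply _ MeasurableSet.univ, withDensity_apply _ MeasurableSet.univ]
      simpa using huniv
  have h3 := congrArg (fun ν => ν t) htrim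
  simpa only [trim_measurableSet_eq hle ht, withDensity_apply _ (hle _ ht)] using h3

/-- Two functions with the same integrals over the sets of `m` have the same integrals against
weights that are `m`-measurable. -/
theorem lintegral_mul_eq_of_setLIntegral_eq {Ω : Type*} {m mΩ : MeasurableSpace Ω}
    {μ : Measure Ω} (hm : m ≤ mΩ) {f g k : Ω → ℝ≥0∞} (hf : Measurable f)
    (hg : Measurable g) (hk : Measurable[m] k)
    (h : ∀ t, MeasurableSet[m] t → ∫⁻ ω in t, f ω ∂μ = ∫⁻ ω in t, g ω ∂μ) :
    ∫⁻ ω, f ω * k ω ∂μ = ∫⁻ ω, g ω * k ω ∂μ := by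
  have htrim : (μ.withDensity f).trim hm = (μ.withDensity g).trim hm := by
    refine @Measure.ext Ω m _ _ fun t ht => ?_
    rw [trim_measurableSet_eq hm ht, trim_measurableSet_eq hm ht,
      withDensity_apply _ (hm _ ht), withDensity_apply _ (hm _ ht), h t ht]
  have hk' : Measurable k := hk.mono hm le_rfl
  have h3 := congrArg (fun ν => @lintegral _ m ν k) htrim
  simp only [lintegral_trim hm hk] at h3
  rwa [lintegral_withDensity_eq_lintegral_mul _ hf hk',
    lintegral_withDensity_eq_lintegral_mul _ hg hk'] at h3

/-- Conditional independence of the σ-algebras `m₁` and `m₂` given `m`, for an arbitrary measurable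
space: the conditional expectation given `m₁ ⊔ m` of a nonnegative integrable function that is
measurable w.r.t. `m₂` has an `m`-measurable version. -/
def CondIndepGiven {Ω : Type*} {mΩ : MeasurableSpace Ω} (μ : Measure Ω)
    (m₁ m₂ m : MeasurableSpace Ω) : Prop :=
  ∀ h : Ω → ℝ≥0∞, Measurable[m₂] h → ∫⁻ ω, h ω ∂μ ≠ ∞ →
    ∃ g : Ω → ℝ≥0∞, Measurable[m] g ∧
      ∀ t, MeasurableSet[m₁ ⊔ m] t → ∫⁻ ω in t, h ω ∂μ = ∫⁻ ω in t, g ω ∂μ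

section CondIndep

variable {Ω : Type*} {m₁ m₂ m m' mΩ : MeasurableSpace Ω} {μ : Measure Ω}

theorem CondIndepGiven.mono_right (h : CondIndepGiven μ m₁ m₂ m) (hm' : m' ≤ m₂) :
    CondIndepGiven μ m₁ m' m :=
  fun f hf hfi => h f (hf.mono hm' le_rfl) hfi

/-- Weak union: information from the side of `m₁` may be added to the condition. -/
theorem CondIndepGiven.weak_union_left (h : CondIndepGiven μ m₁ m₂ m)
    (hm' : m' ≤ m₁ ⊔ m) : CondIndepGiven μ m₁ m₂ (m ⊔ m') := by
  intro f hf hfi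
  obtain ⟨g, hg, hgt⟩ := h f hf hfi
  exact ⟨g, hg.mono le_sup_left le_rfl, fun t ht =>
    hgt t ((sup_le le_sup_left (sup_le le_sup_right hm') : m₁ ⊔ (m ⊔ m') ≤ m₁ ⊔ m) t ht)⟩

/-- Conditional independence is symmetric, and the condition may be included in `m₁`. -/
theorem CondIndepGiven.symm [IsFiniteMeasure μ] (h : CondIndepGiven μ m₁ m₂ m)
    (h₁ : m₁ ≤ mΩ) (h₂ : m₂ ≤ mΩ) (hm : m ≤ mΩ) : CondIndepGiven μ m₂ (m₁ ⊔ m) m := by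
  intro f hf hfi
  have hle : m ≤ m₁ ⊔ m := le_sup_right
  have hf' : Measurable f := hf.mono (sup_le h₁ hm) le_rfl
  have hg : Measurable[m] (μ⁻[f|m]) := measurable_condLExp _ _ _
  have hg' : Measurable (μ⁻[f|m]) := hg.mono hm le_rfl
  refine ⟨μ⁻[f|m], hg, fun t ht => setLIntegral_eq_of_sup h₂ hm hfi ?_ ht⟩
  clear t ht
  intro t ht r hr
  have ht' : MeasurableSet t := h₂ _ ht
  have hr' : MeasurableSet r := hm _ hr
  have hone : Measurable[m₂] (t.indicator (1 : Ω → ℝ≥0∞)) :=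
    (show Measurable[m₂] (1 : Ω → ℝ≥0∞) from measurable_const).indicator ht
  -- Below, `k` is an `m`-measurable version of the conditional probability of `t` given `m₁ ⊔ m`.
  obtain ⟨k, hk, hkt⟩ := h (t.indicator 1) hone (by
    rw [lintegral_indicator_one ht']
    exact measure_ne_top μ t)
  have hone' : Measurable (t.indicator (1 : Ω → ℝ≥0∞)) := hone.mono h₂ le_rfl
  have hk' : Measurable k := hk.mono hm le_rfl
  have hswap : ∀ p : Ω → ℝ≥0∞, Measurable[m₁ ⊔ m] p →
      ∫⁻ ω in t ∩ r, p ω ∂μ = ∫⁻ ω, p ω * r.indicator k ω ∂μ := by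
    intro p hp
    rw [← lintegral_indicator (ht'.inter hr')]
    have h3 := lintegral_mul_eq_of_setLIntegral_eq (sup_le h₁ hm) hone' hk'
      (hp.indicator (hle _ hr)) hkt
    refine (lintegral_congr fun ω => ?_).trans (h3.trans (lintegral_congr fun ω => ?_))
    · by_cases hωt : ω ∈ t <;> by_cases hωr : ω ∈ r <;> simp [hωt, hωr]
    · by_cases hωr : ω ∈ r <;> simp [hωr, mul_comm]
  rw [hswap f hf, hswap _ (hg.mono hle le_rfl)]
  exact lintegral_mul_eq_of_setLIntegral_eq hm hf' hg' (hk.indicator hr) fun t ht =>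
    (setLIntegral_condLExp hm μ f ht).symm

/-- Weak union: information from the side of `m₂` may be added to the condition. -/
theorem CondIndepGiven.weak_union_right [IsFiniteMeasure μ] (h : CondIndepGiven μ m₁ m₂ m)
    (h₁ : m₁ ≤ mΩ) (h₂ : m₂ ≤ mΩ) (hm : m ≤ mΩ) (hm' : m' ≤ m₂ ⊔ m) :
    CondIndepGiven μ m₁ m₂ (m ⊔ m') :=
  ((((h.symm h₁ h₂ hm).mono_right le_sup_left).weak_union_left hm').symm h₂ h₁
    (sup_le hm (hm'.trans (sup_le h₂ hm)))).mono_right le_sup_left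

end CondIndep

section CompProd

variable {Ω E : Type*}

/-- Contraction: if a new variable is drawn from a kernel which depends on the state through
`m₁ ⊔ m` only, then it may be added to `m₁`. -/
theorem CondIndepGiven.sup_comap_snd {m₁ m₂ m : MeasurableSpace (Ω × E)}
    {mΩ : MeasurableSpace Ω} {mE : MeasurableSpace E} {μ : Measure Ω} {κ : Kernel Ω E}
    [IsFiniteMeasure μ] [IsMarkovKernel κ] (h : CondIndepGiven (μ ⊗ₘ κ) m₁ m₂ m)
    (h₁ : m₁ ≤ mΩ.comap Prod.fst) (h₂ : m₂ ≤ mΩ.comap Prod.fst) (hm : m ≤ mΩ.comap Prod.fst)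
    (hκ : ∀ B, MeasurableSet B → Measurable[m₁ ⊔ m] fun z : Ω × E => κ z.1 B) :
    CondIndepGiven (μ ⊗ₘ κ) (m₁ ⊔ mE.comap Prod.snd) m₂ m := by
  have hfst : mΩ.comap (Prod.fst : Ω × E → Ω) ≤ mΩ.prod mE := measurable_fst.comap_le
  have hsnd : mE.comap (Prod.snd : Ω × E → E) ≤ mΩ.prod mE := measurable_snd.comap_le
  -- A function of the first component, integrated over the event that the draw is in `B`.
  have hdraw : ∀ F : Ω × E → ℝ≥0∞, Measurable[mΩ.comap Prod.fst] F → ∀ B, MeasurableSet B →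
      ∫⁻ z in Prod.snd ⁻¹' B, F z ∂(μ ⊗ₘ κ) = ∫⁻ z, F z * κ z.1 B ∂(μ ⊗ₘ κ) := by
    intro F hF B hB
    obtain ⟨F, hF', rfl⟩ := hF.exists_eq_measurable_comp
    have hB' := κ.measurable_coe hB
    rw [← lintegral_indicator (measurable_snd hB), Measure.lintegral_compProd
        ((hF'.comp measurable_fst).indicator (measurable_snd hB)),
      Measure.lintegral_compProd (by fun_prop)]
    refine lintegral_congr fun ω => ?_
    have : (fun x => (Prod.snd ⁻¹' B).indicator (F ∘ Prod.fst) (ω, x)) =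
        B.indicator fun _ : E => F ω := by
      funext x
      by_cases hx : x ∈ B <;> simp [hx]
    rw [this, lintegral_indicator hB]
    simp
  intro f hf hfi
  obtain ⟨g, hg, hgt⟩ := h f hf hfi
  have hf' : Measurable[mΩ.comap Prod.fst] f := hf.mono h₂ le_rfl
  have hg' : Measurable[mΩ.comap Prod.fst] g := hg.mono hm le_rfl
  refine ⟨g, hg, fun t ht => ?_⟩
  rw [sup_right_comm] at ht
  refine setLIntegral_eq_of_sup ((sup_le h₁ hm).trans hfst) hsnd hfi ?_ ht
  rintro s hs _ ⟨B, hB, rfl⟩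
  have hs' : MeasurableSet[mΩ.comap Prod.fst] s := (sup_le h₁ hm) _ hs
  have hind : ∀ p : Ω × E → ℝ≥0∞, ∫⁻ z in s ∩ Prod.snd ⁻¹' B, p z ∂(μ ⊗ₘ κ) =
      ∫⁻ z in Prod.snd ⁻¹' B, s.indicator p z ∂(μ ⊗ₘ κ) := fun p => by
    rw [lintegral_indicator (hfst _ hs'), Measure.restrict_restrict (hfst _ hs')]
  rw [hind, hind, hdraw _ (hf'.indicator hs') B hB, hdraw _ (hg'.indicator hs') B hB]
  refine lintegral_mul_eq_of_setLIntegral_eq ((sup_le h₁ hm).trans hfst)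
    ((hf'.indicator hs').mono hfst le_rfl) ((hg'.indicator hs').mono hfst le_rfl) (hκ B hB) ?_
  intro t ht
  rw [lintegral_indicator (hfst _ hs'), lintegral_indicator (hfst _ hs'),
    Measure.restrict_restrict (hfst _ hs')]
  exact hgt _ (@MeasurableSet.inter _ (m₁ ⊔ m) _ _ hs ht)

/-- Independent parts of the randomness remain independent of each other when an independent first
component `ι` is added to one of them. The measure on `ι` need not be normalized. -/
theorem condIndepGiven_bot_of_indep {ι : Type*} {m₁ m₂ mΩ : MeasurableSpace Ω}
    {mι : MeasurableSpace ι} {mE : MeasurableSpace E} {μ : Measure Ω} [IsProbabilityMeasure μ]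
    {ν : Measure ι} [IsFiniteMeasure ν] {κ : Kernel (ι × Ω) E} [IsMarkovKernel κ]
    (h₁ : m₁ ≤ mΩ) (h₂ : m₂ ≤ mΩ) (h : Indep m₁ m₂ μ) :
    CondIndepGiven ((ν.prod μ) ⊗ₘ κ)
      (mι.comap (fun z : (ι × Ω) × E => z.1.1) ⊔ m₁.comap fun z : (ι × Ω) × E => z.1.2)
      (m₂.comap fun z : (ι × Ω) × E => z.1.2) ⊥ := by
  have hmeas : Measurable fun z : (ι × Ω) × E => z.1.1 := by fun_prop
  have hmeas' : Measurable fun z : (ι × Ω) × E => z.1.2 := by fun_prop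
  have hint : ∀ F : Ω → ℝ≥0∞, Measurable F → ∀ b : Set ι, MeasurableSet b → ∀ s : Set Ω,
      MeasurableSet s → ∫⁻ z in (fun z : (ι × Ω) × E => z.1.1) ⁻¹' b ∩ (fun z => z.1.2) ⁻¹' s,
        F z.1.2 ∂((ν.prod μ) ⊗ₘ κ) = ν b * ∫⁻ ω in s, F ω ∂μ := by
    intro F hF b hb s hs
    have : (fun z : (ι × Ω) × E => z.1.1) ⁻¹' b ∩ (fun z => z.1.2) ⁻¹' s =
        Prod.fst ⁻¹' (b ×ˢ s) := by ext; simp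
    rw [this, ← setLIntegral_map (f := fun y : ι × Ω => F y.2) (hb.prod hs) (by fun_prop)
      measurable_fst]
    change ∫⁻ y in b ×ˢ s, F y.2 ∂((ν.prod μ) ⊗ₘ κ).fst = _
    rw [Measure.fst_compProd, ← Measure.prod_restrict, lintegral_prod _ (by fun_prop)]
    simp [mul_comm]
  intro f hf hfi
  obtain ⟨F, hF, rfl⟩ := hf.exists_eq_measurable_comp (mY := m₂)
  have hF' : Measurable F := hF.mono h₂ le_rfl
  refine ⟨fun _ => ∫⁻ ω, F ω ∂μ, measurable_const, fun t ht => ?_⟩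
  rw [sup_bot_eq] at ht
  refine setLIntegral_eq_of_sup hmeas.comap_le
    ((MeasurableSpace.comap_mono h₁).trans hmeas'.comap_le) hfi ?_ ht
  rintro _ ⟨b, hb, rfl⟩ _ ⟨s, hs, rfl⟩
  have hs' := h₁ _ hs
  have hmul := lintegral_mul_eq_lintegral_mul_lintegral_of_independent_measurableSpace h₁ h₂ h
    ((show Measurable[m₁] (1 : Ω → ℝ≥0∞) from measurable_const).indicator hs) hF
  have e1 : ∫⁻ ω in s, F ω ∂μ = ∫⁻ ω, s.indicator 1 ω * F ω ∂μ := by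
    rw [← lintegral_indicator hs']
    refine lintegral_congr fun ω => ?_
    by_cases hω : ω ∈ s <;> simp [hω]
  have e2 := hint F hF' b hb s hs'
  have e3 := hint (fun _ => ∫⁻ ω, F ω ∂μ) measurable_const b hb s hs'
  simp only [Function.comp_apply]
  rw [e2, e3, e1, hmul, lintegral_indicator_one hs', lintegral_const, Measure.restrict_apply_univ,
    mul_comm (μ s)]

end CompProd

/-! ### The model with a switch -/

namespace SCM

variable {V : Type u} {D : V → Type v} [∀ a, MeasurableSpace (D a)]

theorem solve_act_self [Finite V] (M : SCM.{u, v, w} V D) (X : V) (x : D X) (s : M.Exo) :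
    M.solve (act X x) s X = x := by
  rw [solve_eq]
  simp [act]

theorem solve_act_of_ne [Finite V] (M : SCM.{u, v, w} V D) {X a : V} (h : a ≠ X) (x : D X)
    (s : M.Exo) : M.solve (act X x) s a =
      M.f a (fun b => M.solve (act X x) s b.1) (fun j => s j.1) := by
  rw [solve_eq]
  simp [act, noAct, h]

theorem solve_noAct [Finite V] (M : SCM.{u, v, w} V D) (s : M.Exo) (a : V) :
    M.solve noAct s a = M.f a (fun b => M.solve noAct s b.1) (fun j => s j.1) := by
  rw [solve_eq]
  rfl

/-- Consistency: setting `X` to the value that it has anyway changes nothing. -/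
theorem solve_act_solve_noAct [Finite V] (M : SCM.{u, v, w} V D) (X : V) (s : M.Exo) :
    M.solve (act X (M.solve noAct s X)) s = M.solve noAct s := by
  funext a
  induction a using M.wellFounded.induction with
  | _ a ih =>
    by_cases h : a = X
    · subst h
      exact M.solve_act_self _ _ s
    · rw [M.solve_act_of_ne h, M.solve_noAct s a]
      congr 1
      funext b
      exact ih b.1 b.2

section Measurability

variable {Ω : Type*} {mΩ : MeasurableSpace Ω} {X : V}

theorem measurable_f_comp (M : SCM.{u, v, w} V D) {s : Ω → M.Exo} {v : Ω → ∀ a, D a} {a : V}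
    (hv : ∀ b ∈ M.pa a, Measurable fun ω => v ω b)
    (hs : ∀ j ∈ M.exo a, Measurable fun ω => s ω j) :
    Measurable fun ω => M.f a (fun b => v ω b.1) (fun j => s ω j.1) :=
  (M.measurable_f a).comp ((measurable_pi_lambda _ fun b => hv b.1 b.2).prodMk
    (measurable_pi_lambda _ fun j => hs j.1 j.2))

/-- The value of `a` under an intervention on `X` is measurable w.r.t. every σ-algebra that contains
the values of its parents and of its exogenous variables, and the action if `a` is `X`. -/
theorem measurable_solve_act_apply [Finite V] (M : SCM.{u, v, w} V D) {s : Ω → M.Exo}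
    {x : Ω → D X} {a : V} (hx : a = X → Measurable x)
    (hv : ∀ b ∈ M.pa a, Measurable fun ω => M.solve (act X (x ω)) (s ω) b)
    (hs : ∀ j ∈ M.exo a, Measurable fun ω => s ω j) :
    Measurable fun ω => M.solve (act X (x ω)) (s ω) a := by
  by_cases h : a = X
  · subst h
    simpa only [solve_act_self] using hx rfl
  · simpa only [M.solve_act_of_ne h] using M.measurable_f_comp hv hs

/-- Suppose that the mechanisms of a set `F` of nodes receive no endogenous input from outside
`F ∪ S`. Then the values of `F` are functions of those of `S`, of the exogenous variables of `F`,
and of the action if `X ∈ F`. The set `K`, closed under taking parents, restricts this to the values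
that are determined early. -/
theorem measurable_solve_act_of_mem [Finite V] (M : SCM.{u, v, w} V D) {s : Ω → M.Exo}
    {x : Ω → D X} {F S K : Set V} (hK : ∀ a ∈ K, ∀ b ∈ M.pa a, b ∈ K)
    (hF : ∀ a ∈ F, ∀ b ∈ M.pa a, b ∈ F ∪ S) (hx : X ∈ F → X ∈ K → Measurable x)
    (hS : ∀ a ∈ S ∩ K, Measurable fun ω => M.solve (act X (x ω)) (s ω) a)
    (hs : ∀ a ∈ F, ∀ j ∈ M.exo a, Measurable fun ω => s ω j) {a : V} (ha : a ∈ F ∪ S)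
    (haK : a ∈ K) : Measurable fun ω => M.solve (act X (x ω)) (s ω) a := by
  induction a using M.wellFounded.induction with
  | _ a ih =>
    by_cases haS : a ∈ S
    · exact hS a ⟨haS, haK⟩
    · have haF : a ∈ F := ha.resolve_right haS
      refine M.measurable_solve_act_apply ?_ (fun b hb => ih b hb (hF a haF b hb) (hK a haK b hb))
        (hs a haF)
      rintro rfl
      exact hx haF haK

end Measurability

/-- The σ-algebra generated by the exogenous variables in `J'`. -/
@[reducible]
noncomputable def exoSigma (M : SCM.{u, v, w} V D) (J' : Set M.J) : MeasurableSpace M.Exo :=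
  ⨆ j ∈ J', (M.measurableSpaceE j).comap fun s => s j

theorem exoSigma_le (M : SCM.{u, v, w} V D) (J' : Set M.J) :
    M.exoSigma J' ≤ MeasurableSpace.pi :=
  iSup₂_le fun j _ => (measurable_pi_apply j).comap_le

theorem indep_exoSigma (M : SCM.{u, v, w} V D) {J₁ J₂ : Set M.J} (h : Disjoint J₁ J₂) :
    Indep (M.exoSigma J₁) (M.exoSigma J₂) M.exoLaw :=
  indep_iSup_of_disjoint (fun j => (measurable_pi_apply j).comap_le)
    (iIndepFun_pi (μ := M.noise) (X := fun _ => id) fun _ => aemeasurable_id) h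

/-- The σ-algebra generated by the switch and by the exogenous variables in `J'`. -/
@[reducible]
noncomputable def switchSigma (M : SCM.{u, v, w} V D) (X : V) (J' : Set M.J) :
    MeasurableSpace ((Bool × M.Exo) × D X) :=
  MeasurableSpace.comap (fun z => z.1.1) inferInstance ⊔ (M.exoSigma J').comap fun z => z.1.2

section Switch

variable [Finite V] {X : V} {C : Set V}

theorem measurable_solve_noAct_apply (M : SCM.{u, v, w} V D) (a : V) :
    Measurable fun s => M.solve noAct s a :=
  (measurable_pi_apply a).comp M.measurable_solve_noAct

/-- The mechanism of the action with a switch: if the switch is on, the action is drawn from the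
policy, and otherwise it takes its natural value. -/
noncomputable def switchKernel (M : SCM.{u, v, w} V D) (π : Kernel (∀ a : C, D a) (D X)) :
    Kernel (Bool × M.Exo) (D X) :=
  Kernel.piecewise (show MeasurableSet {p : Bool × M.Exo | p.1 = true} from
      measurable_fst (measurableSet_singleton true))
    ((π.comap (fun s => C.domRestrict (M.solve noAct s))
      ((Set.measurable_restrict C).comp M.measurable_solve_noAct)).comap Prod.snd measurable_snd)
    ((Kernel.deterministic (fun s => M.solve noAct s X)
      (M.measurable_solve_noAct_apply X)).comap Prod.snd measurable_snd)

instance (M : SCM.{u, v, w} V D) (π : Kernel (∀ a : C, D a) (D X)) [IsMarkovKernel π] :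
    IsMarkovKernel (M.switchKernel π) := by
  have := Kernel.IsMarkovKernel.comap π
    ((Set.measurable_restrict C).comp M.measurable_solve_noAct)
  exact Kernel.IsMarkovKernel.piecewise

/-- The law of the switch, the exogenous variables and the action. The two positions of the switch
have mass one each, so that the total mass is two. -/
noncomputable def switchLaw (M : SCM.{u, v, w} V D) (π : Kernel (∀ a : C, D a) (D X)) :
    Measure ((Bool × M.Exo) × D X) :=
  (Measure.count.prod M.exoLaw) ⊗ₘ M.switchKernel π

instance (M : SCM.{u, v, w} V D) (π : Kernel (∀ a : C, D a) (D X)) [IsMarkovKernel π] :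
    IsFiniteMeasure (M.switchLaw π) := by
  unfold switchLaw
  infer_instance

/-- The values of the endogenous variables, as functions of the exogenous variables and of the
action; the switch acts on them through the action only. -/
noncomputable def switchValue (M : SCM.{u, v, w} V D) (X : V) (z : (Bool × M.Exo) × D X) :
    ∀ a, D a :=
  M.solve (act X z.2) z.1.2

theorem measurable_switchValue (M : SCM.{u, v, w} V D) (X : V) :
    Measurable (M.switchValue X) :=
  (M.measurable_solve_act X).comp
    (f := fun z : (Bool × M.Exo) × D X => (z.1.2, z.2)) (by fun_prop)

theorem setLIntegral_switchLaw (M : SCM.{u, v, w} V D) (π : Kernel (∀ a : C, D a) (D X))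
    [IsMarkovKernel π] (i : Bool) {F : (Bool × M.Exo) × D X → ℝ≥0∞} (hF : Measurable F) :
    ∫⁻ z in {z | z.1.1 = i}, F z ∂M.switchLaw π =
      ∫⁻ s, ∫⁻ x, F ((i, s), x) ∂M.switchKernel π (i, s) ∂M.exoLaw := by
  have hset : {z : (Bool × M.Exo) × D X | z.1.1 = i} = ({i} ×ˢ Set.univ) ×ˢ Set.univ := by
    ext; simp
  rw [hset, switchLaw, Measure.setLIntegral_compProd hF
    ((measurableSet_singleton i).prod MeasurableSet.univ) MeasurableSet.univ]
  simp only [Measure.restrict_univ]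
  rw [← Measure.prod_restrict, lintegral_prod _ hF.lintegral_kernel_prod_right'.aemeasurable,
    Measure.restrict_univ, Measure.restrict_singleton]
  simp

/-- If the switch is on, then the endogenous variables have their law under the policy. -/
theorem setLIntegral_switchLaw_true (M : SCM.{u, v, w} V D) (π : Kernel (∀ a : C, D a) (D X))
    [IsMarkovKernel π] {F : (∀ a, D a) → ℝ≥0∞} (hF : Measurable F) :
    ∫⁻ z in {z | z.1.1 = true}, F (M.switchValue X z) ∂M.switchLaw π =
      ∫⁻ v, F v ∂M.doLaw π := by
  rw [M.setLIntegral_switchLaw π true (F := fun z => F (M.switchValue X z))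
    (hF.comp (M.measurable_switchValue X)), doLaw,
    lintegral_map hF (M.measurable_solve_act X),
    Measure.lintegral_compProd (f := fun z => F (M.solve (act X z.2) z.1))
      (hF.comp (M.measurable_solve_act X))]
  refine lintegral_congr fun s => ?_
  simp [switchKernel, switchValue, Kernel.piecewise_apply]

/-- If the switch is off, then the endogenous variables have their observational law. -/
theorem setLIntegral_switchLaw_false (M : SCM.{u, v, w} V D) (π : Kernel (∀ a : C, D a) (D X))
    [IsMarkovKernel π] {F : (∀ a, D a) → ℝ≥0∞} (hF : Measurable F) :
    ∫⁻ z in {z | z.1.1 = false}, F (M.switchValue X z) ∂M.switchLaw π = ∫⁻ v, F v ∂M.law := by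
  rw [M.setLIntegral_switchLaw π false (F := fun z => F (M.switchValue X z))
    (hF.comp (M.measurable_switchValue X)), law, lintegral_map hF M.measurable_solve_noAct]
  refine lintegral_congr fun s => ?_
  have hm : Measurable fun x => F (M.solve (act X x) s) :=
    hF.comp ((M.measurable_solve_act X).comp measurable_prodMk_left)
  simp [switchKernel, switchValue, Kernel.piecewise_apply, Kernel.deterministic_apply,
    lintegral_dirac' _ hm, solve_act_solve_noAct]

/-- The σ-algebra generated by the endogenous variables in `A`, on the space of the model with a
switch. -/
@[reducible]
noncomputable def valueSigma (M : SCM.{u, v, w} V D) (X : V) (A : Set V) :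
    MeasurableSpace ((Bool × M.Exo) × D X) :=
  ⨆ a ∈ A, MeasurableSpace.comap (fun z => M.switchValue X z a) inferInstance

theorem valueSigma_le (M : SCM.{u, v, w} V D) (X : V) (A : Set V) :
    M.valueSigma X A ≤ MeasurableSpace.prod inferInstance inferInstance :=
  iSup₂_le fun a _ => ((measurable_pi_apply a).comp (M.measurable_switchValue X)).comap_le

theorem measurable_valueSigma (M : SCM.{u, v, w} V D) (X : V) {A : Set V} {a : V} (ha : a ∈ A) :
    Measurable[M.valueSigma X A] fun z => M.switchValue X z a :=
  Measurable.of_comap_le (le_iSup₂_of_le a ha le_rfl)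

theorem valueSigma_eq_comap (M : SCM.{u, v, w} V D) (X : V) (A : Set V) :
    M.valueSigma X A =
      MeasurableSpace.comap (fun z => A.domRestrict (M.switchValue X z)) inferInstance := by
  refine le_antisymm (iSup₂_le fun a ha => ?_) ?_
  · have : Measurable fun y : ∀ b : A, D b => y ⟨a, ha⟩ := measurable_pi_apply _
    exact (this.comp (comap_measurable
      fun z => A.domRestrict (M.switchValue X z))).comap_le
  · refine Measurable.comap_le (@measurable_pi_lambda _ _ _ (M.valueSigma X A) _ _ fun b => ?_)
    exact M.measurable_valueSigma X b.2

end Switch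

end SCM

/-! ### Conditional independence of switch and reward given the surrogate -/

section Separation

variable {V : Type u} {D : V → Type v} [∀ a, MeasurableSpace (D a)] {X : V}

open SCM

/-- The σ-algebra generated by non-descendants of the action does not involve the action. -/
theorem SCM.valueSigma_le_comap_fst [Finite V] (M : SCM.{u, v, w} V D) {A : Set V}
    (hA : ∀ a ∈ A, ¬ Relation.ReflTransGen (fun b c => b ∈ M.pa c) X a) :
    M.valueSigma X A ≤ MeasurableSpace.comap Prod.fst inferInstance := by
  refine iSup₂_le fun a ha => ?_
  have h1 : (fun z : (Bool × M.Exo) × D X => M.switchValue X z a) =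
      (fun s => M.solve noAct s a) ∘ Prod.snd ∘ Prod.fst := by
    funext z
    exact M.solve_act_of_not_descendant X z.2 z.1.2 a (hA a ha)
  rw [h1, ← Function.comp_assoc, ← MeasurableSpace.comap_comp]
  exact MeasurableSpace.comap_mono
    ((M.measurable_solve_noAct_apply a).comp measurable_snd).comap_le

theorem SCM.measurable_exo_of_mem (M : SCM.{u, v, w} V D) {J' : Set M.J} {j : M.J} (hj : j ∈ J') :
    Measurable[(M.exoSigma J').comap fun z : (Bool × M.Exo) × D X => z.1.2]
      fun z : (Bool × M.Exo) × D X => z.1.2 j := by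
  have h1 : Measurable[M.exoSigma J'] fun s : M.Exo => s j :=
    Measurable.of_comap_le (le_iSup₂_of_le j hj le_rfl)
  exact h1.comp (comap_measurable _)

/-- The σ-algebra generated by the switch, by the exogenous variables in `J'` and, if `X ∈ K`, by
the action. -/
@[reducible]
noncomputable def SCM.actionSigma (M : SCM.{u, v, w} V D) (X : V) (J' : Set M.J) (K : Set V) :
    MeasurableSpace ((Bool × M.Exo) × D X) :=
  M.switchSigma X J' ⊔ ⨆ _ : X ∈ K, MeasurableSpace.comap Prod.snd inferInstance

theorem SCM.actionSigma_of_notMem (M : SCM.{u, v, w} V D) (J' : Set M.J) {K : Set V}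
    (h : X ∉ K) : M.actionSigma X J' K = M.switchSigma X J' := by
  rw [actionSigma, iSup_neg h, sup_bot_eq]

theorem SCM.actionSigma_of_mem (M : SCM.{u, v, w} V D) (J' : Set M.J) {K : Set V}
    (h : X ∈ K) : M.actionSigma X J' K =
      M.switchSigma X J' ⊔ MeasurableSpace.comap Prod.snd inferInstance := by
  rw [actionSigma, iSup_pos h]

theorem SCM.actionSigma_insert_of_ne (M : SCM.{u, v, w} V D) (J' : Set M.J) {K : Set V} {a : V}
    (h : a ≠ X) : M.actionSigma X J' (insert a K) = M.actionSigma X J' K := by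
  have h1 : (X ∈ insert a K) = (X ∈ K) :=
    propext ⟨fun h' => h'.resolve_left (Ne.symm h), Or.inr⟩
  rw [actionSigma, h1]

theorem SCM.comap_exoSigma_le_comap_fst (M : SCM.{u, v, w} V D) (X : V) (J' : Set M.J) :
    ((M.exoSigma J').comap fun z : (Bool × M.Exo) × D X => z.1.2) ≤
      MeasurableSpace.comap Prod.fst Prod.instMeasurableSpace := by
  have : ((M.exoSigma J').comap fun z : (Bool × M.Exo) × D X => z.1.2) =
      ((M.exoSigma J').comap Prod.snd).comap Prod.fst :=
    (MeasurableSpace.comap_comp ..).symm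
  rw [this]
  exact MeasurableSpace.comap_mono
    ((MeasurableSpace.comap_mono (M.exoSigma_le J')).trans measurable_snd.comap_le)

theorem SCM.switchSigma_le_comap_fst (M : SCM.{u, v, w} V D) (X : V) (J' : Set M.J) :
    M.switchSigma X J' ≤ MeasurableSpace.comap Prod.fst Prod.instMeasurableSpace := by
  refine sup_le ?_ (M.comap_exoSigma_le_comap_fst X J')
  have : (MeasurableSpace.comap (fun z : (Bool × M.Exo) × D X => z.1.1) inferInstance) =
      (MeasurableSpace.comap Prod.fst inferInstance).comap Prod.fst :=
    (MeasurableSpace.comap_comp ..).symm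
  rw [this]
  exact MeasurableSpace.comap_mono measurable_fst.comap_le

theorem SCM.actionSigma_le (M : SCM.{u, v, w} V D) (X : V) (J' : Set M.J) (K : Set V) :
    M.actionSigma X J' K ≤ Prod.instMeasurableSpace :=
  sup_le ((M.switchSigma_le_comap_fst X J').trans measurable_fst.comap_le)
    (iSup_le fun _ => measurable_snd.comap_le)

theorem SCM.not_descendant_of_mem (M : SCM.{u, v, w} V D) {K : Set V}
    (hK : ∀ a ∈ K, ∀ b ∈ M.pa a, b ∈ K) (hX : X ∉ K) {a : V} (ha : a ∈ K) :
    ¬ Relation.ReflTransGen (fun b c => b ∈ M.pa c) X a := by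
  intro h
  induction h with
  | refl => exact hX ha
  | @tail b c _ hbc ih => exact ih (hK c ha b hbc)

variable [Finite V] {M : POSCM.{u, v, w} V D} {Pol : PolicySpace M.diagram X} {S F₁ F₂ : Set V}

/-- The kernel that draws the action depends only on the switch, on the exogenous variables of the
part `F₁` of the model which contains the mechanism of the action, and on the values of `S` that are
determined before the action. -/
theorem measurable_switchKernel_of_split (π : Policy Pol D) {K : Set V} (hXF : X ∈ F₁)
    (hF₁ : ∀ a ∈ F₁, ∀ b, policyDir Pol b a → b ∈ F₁ ∪ S)
    (hK : ∀ a ∈ K, ∀ b, policyDir Pol b a → b ∈ K) (hXK : X ∉ K)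
    (hpre : ∀ b, policyDir Pol b X → b ∈ K) {B : Set (D X)} (hB : MeasurableSet B) :
    Measurable[M.switchSigma X (⋃ a ∈ F₁, M.exo a) ⊔ M.valueSigma X (S ∩ K)]
      fun z : (Bool × M.Exo) × D X => M.switchKernel π.kernel z.1 B := by
  set 𝓜 := M.switchSigma X (⋃ a ∈ F₁, M.exo a) ⊔ M.valueSigma X (S ∩ K)
  have hnd : ∀ a ∈ K, ¬ Relation.ReflTransGen (fun b c => b ∈ M.pa c) X a := fun a ha =>
    M.not_descendant_of_mem (fun a ha b hb => hK a ha b (.inl hb)) hXK ha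
  have hexo : ∀ a ∈ F₁, ∀ j ∈ M.exo a,
      Measurable[𝓜] fun z : (Bool × M.Exo) × D X => z.1.2 j := fun a ha j hj =>
    (M.measurable_exo_of_mem (Set.mem_biUnion ha hj)).mono
      (le_sup_of_le_left le_sup_right) le_rfl
  have hval : ∀ b, policyDir Pol b X →
      Measurable[𝓜] fun z : (Bool × M.Exo) × D X => M.solve noAct z.1.2 b := by
    intro b hb
    have h1 : Measurable[𝓜] fun z : (Bool × M.Exo) × D X => M.solve (act X z.2) z.1.2 b :=
      M.measurable_solve_act_of_mem (mΩ := 𝓜) (F := F₁) (S := S) (K := K)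
        (fun a ha b hb => hK a ha b (.inl hb)) (fun a ha b hb => hF₁ a ha b (.inl hb))
        (fun _ h => absurd h hXK)
        (fun a ha => (M.measurable_valueSigma X ha).mono le_sup_right le_rfl)
        hexo (hF₁ X hXF b hb) (hpre b hb)
    convert h1 using 2 with z
    exact (M.solve_act_of_not_descendant X z.2 z.1.2 b (hnd b (hpre b hb))).symm
  have hnat : Measurable[𝓜] fun z : (Bool × M.Exo) × D X => M.solve noAct z.1.2 X := by
    simp only [M.solve_noAct _ X]
    exact M.measurable_f_comp (mΩ := 𝓜) (v := fun z => M.solve noAct z.1.2)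
      (fun b hb => hval b (.inl hb)) (hexo X hXF)
  have hcov : Measurable[𝓜] fun z : (Bool × M.Exo) × D X =>
      Pol.cov.domRestrict (M.solve noAct z.1.2) :=
    @measurable_pi_lambda _ _ _ 𝓜 _ _ fun b => hval b.1 (.inr ⟨b.2, rfl⟩)
  have hbool : MeasurableSet[𝓜] {z : (Bool × M.Exo) × D X | z.1.1 = true} :=
    (le_sup_of_le_left le_sup_left : MeasurableSpace.comap _ _ ≤ 𝓜) _
      ⟨{true}, measurableSet_singleton true, rfl⟩
  have h2 : Measurable[𝓜] fun z : (Bool × M.Exo) × D X => if z.1.1 = true then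
      π.kernel (Pol.cov.domRestrict (M.solve noAct z.1.2)) B else
      B.indicator (1 : D X → ℝ≥0∞) (M.solve noAct z.1.2 X) :=
    Measurable.ite (m := 𝓜) hbool ((π.kernel.measurable_coe hB).comp hcov)
      (((measurable_one (α := ℝ≥0∞)).indicator hB).comp hnat)
  convert h2 using 2 with z
  rw [switchKernel, Kernel.piecewise_apply']
  simp only [Set.mem_ofPred_eq, Kernel.comap_apply,
    Kernel.deterministic_apply, Measure.dirac_apply' _ hB]

/-- In the model with a switch, the side of the action, including the switch, and the side of the
reward are conditionally independent given `S`. -/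
theorem condIndepGiven_switchLaw (π : Policy Pol D) (hXF : X ∈ F₁) (hSF : S ⊆ F₁ ∪ F₂)
    (hdisj : Disjoint F₁ F₂) (hF₁ : ∀ a ∈ F₁, ∀ b, policyDir Pol b a → b ∈ F₁ ∪ S)
    (hF₂ : ∀ a ∈ F₂, ∀ b, policyDir Pol b a → b ∈ F₂ ∪ S)
    (hbi : ∀ a ∈ F₁, ∀ b ∈ F₂, ¬ M.diagram.bi a b) :
    CondIndepGiven (M.switchLaw π.kernel)
      (M.switchSigma X (⋃ a ∈ F₁, M.exo a) ⊔ MeasurableSpace.comap Prod.snd inferInstance)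
      ((M.exoSigma (⋃ a ∈ F₂, M.exo a)).comap fun z => z.1.2) (M.valueSigma X S) := by
  set J₁ : Set M.J := ⋃ a ∈ F₁, M.exo a
  set J₂ : Set M.J := ⋃ a ∈ F₂, M.exo a
  set m₂ : MeasurableSpace ((Bool × M.Exo) × D X) :=
    (M.exoSigma J₂).comap fun z => z.1.2
  have hJ : Disjoint J₁ J₂ := by
    refine Set.disjoint_left.2 fun j hj₁ hj₂ => ?_
    obtain ⟨a, ha, hja⟩ := Set.mem_iUnion₂.1 hj₁
    obtain ⟨b, hb, hjb⟩ := Set.mem_iUnion₂.1 hj₂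
    exact hbi a ha b hb ⟨hdisj.ne_of_mem ha hb, j, hja, hjb⟩
  have hm₂fst : m₂ ≤ MeasurableSpace.comap Prod.fst Prod.instMeasurableSpace :=
    M.comap_exoSigma_le_comap_fst X J₂
  -- The nodes are processed in a topological order. The action is added to the first side, and the
  -- nodes of `S` to the condition, as soon as they are reached.
  have key : CondIndepGiven (M.switchLaw π.kernel) (M.actionSigma X J₁ Set.univ) m₂
      (M.valueSigma X (S ∩ Set.univ)) := by
    refine set_induction_of_wellFounded (policyDir_wellFounded Pol)
      (p := fun K => CondIndepGiven (M.switchLaw π.kernel) (M.actionSigma X J₁ K) m₂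
        (M.valueSigma X (S ∩ K)))
      ?_ ?_
    · have h1 := condIndepGiven_bot_of_indep (ν := (Measure.count : Measure Bool))
        (κ := M.switchKernel π.kernel) (M.exoSigma_le J₁) (M.exoSigma_le J₂) (M.indep_exoSigma hJ)
      have h2 : M.valueSigma X (S ∩ ∅) = ⊥ := by simp [valueSigma]
      rw [M.actionSigma_of_notMem J₁ (Set.notMem_empty X), h2]
      exact h1
    · intro K a hK haK hpre ih
      have hact : CondIndepGiven (M.switchLaw π.kernel) (M.actionSigma X J₁ (insert a K)) m₂
          (M.valueSigma X (S ∩ K)) := by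
        by_cases haX : a = X
        · subst haX
          rw [M.actionSigma_of_notMem J₁ haK] at ih
          rw [M.actionSigma_of_mem J₁ (Set.mem_insert _ _)]
          exact ih.sup_comap_snd (M.switchSigma_le_comap_fst _ J₁) hm₂fst
            (M.valueSigma_le_comap_fst fun b hb => M.not_descendant_of_mem
              (fun a ha b hb => hK a ha b (.inl hb)) haK hb.2)
            fun B hB => measurable_switchKernel_of_split π hXF hF₁ hK haK hpre hB
        · rwa [M.actionSigma_insert_of_ne J₁ haX]
      by_cases haS : a ∈ S
      · have h1 : M.valueSigma X (S ∩ insert a K) = M.valueSigma X (S ∩ K) ⊔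
            MeasurableSpace.comap (fun z => M.switchValue X z a) inferInstance := by
          rw [Set.inter_insert_of_mem haS, valueSigma, iSup_insert, sup_comm]
        rw [h1]
        -- The value of `a` is determined by the side of its mechanism and by earlier values of `S`.
        have hparent : ∀ (F : Set V) (𝓜 : MeasurableSpace ((Bool × M.Exo) × D X)), a ∈ F →
            (∀ a ∈ F, ∀ b, policyDir Pol b a → b ∈ F ∪ S) →
            (X ∈ F → X ∈ insert a K → MeasurableSpace.comap Prod.snd inferInstance ≤ 𝓜) →
            M.valueSigma X (S ∩ K) ≤ 𝓜 →
            (M.exoSigma (⋃ a ∈ F, M.exo a)).comap (fun z => z.1.2) ≤ 𝓜 →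
            MeasurableSpace.comap (fun z => M.switchValue X z a) inferInstance ≤ 𝓜 := by
          intro F 𝓜 haF hF hx hS hexo
          have hexo' : ∀ a ∈ F, ∀ j ∈ M.exo a,
              Measurable[𝓜] fun z : (Bool × M.Exo) × D X => z.1.2 j := fun a ha j hj =>
            (M.measurable_exo_of_mem (Set.mem_biUnion ha hj)).mono hexo le_rfl
          have hsnd' : MeasurableSpace.comap Prod.snd inferInstance ≤ 𝓜 →
              Measurable[𝓜] (Prod.snd : (Bool × M.Exo) × D X → D X) :=
            fun h => (comap_measurable _).mono h le_rfl
          refine Measurable.comap_le (m₁ := 𝓜) (M.measurable_solve_act_apply (mΩ := 𝓜) ?_ ?_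
            (hexo' a haF))
          · rintro rfl
            exact hsnd' (hx haF (.inl rfl))
          · intro b hb
            exact M.measurable_solve_act_of_mem (mΩ := 𝓜) (F := F) (S := S) (K := K)
              (fun a ha b hb => hK a ha b (.inl hb)) (fun a ha b hb => hF a ha b (.inl hb))
              (fun hXF hXK => hsnd' (hx hXF (.inr hXK)))
              (fun a ha => (M.measurable_valueSigma X ha).mono hS le_rfl)
              hexo' (hF a haF b (.inl hb)) (hpre b (.inl hb))
        obtain haF | haF := hSF haS
        · refine hact.weak_union_left (hparent F₁ _ haF hF₁ (fun _ h => ?_) le_sup_right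
            (le_sup_of_le_left (le_sup_of_le_left le_sup_right)))
          exact le_sup_of_le_left (le_sup_of_le_right (le_iSup_of_le h le_rfl))
        · exact hact.weak_union_right (M.actionSigma_le X J₁ _)
            (hm₂fst.trans measurable_fst.comap_le) (M.valueSigma_le X _)
            (hparent F₂ _ haF hF₂ (fun h => absurd h (Set.disjoint_left.1 hdisj hXF))
              le_sup_right le_sup_left)
      · rwa [Set.inter_insert_of_notMem haS]
  rwa [Set.inter_univ, M.actionSigma_of_mem J₁ (Set.mem_univ X)] at key

/-- If the law of the surrogate under a policy is its observational law, then so is that of the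
reward: the conditional law of the reward given the surrogate does not depend on the switch. -/
theorem marginal_doLaw_eq_of_surrogate {Y : V} (π : Policy Pol D)
    (hXY : Y ∈ M.diagram.descendants X) (hS : IsSurrogate Pol Y S)
    (h : marginal (M.doLaw π.kernel) S = marginal M.law S) :
    marginal (M.doLaw π.kernel) {Y} = marginal M.law {Y} := by
  obtain ⟨F₁, F₂, hXF, hYF, hSF, hdisj, hF₁, hF₂, hbi⟩ := hS.exists_split hXY
  have hci := condIndepGiven_switchLaw π hXF hSF hdisj hF₁ hF₂ hbi
  set m₁ := M.switchSigma X (⋃ a ∈ F₁, M.exo a) ⊔ MeasurableSpace.comap Prod.snd inferInstance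
  set m₂ : MeasurableSpace ((Bool × M.Exo) × D X) :=
    (M.exoSigma (⋃ a ∈ F₂, M.exo a)).comap fun z => z.1.2
  have hm₁le : m₁ ≤ MeasurableSpace.prod inferInstance inferInstance := by
    refine sup_le (sup_le ?_ ?_) measurable_snd.comap_le
    · exact (measurable_fst.comp measurable_fst).comap_le
    · exact (MeasurableSpace.comap_mono (M.exoSigma_le _)).trans
        (measurable_snd.comp measurable_fst).comap_le
  have hm₂le : m₂ ≤ MeasurableSpace.prod inferInstance inferInstance :=
    (MeasurableSpace.comap_mono (M.exoSigma_le _)).trans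
      (measurable_snd.comp measurable_fst).comap_le
  have hσ := M.valueSigma_le X S
  have hci' : CondIndepGiven (M.switchLaw π.kernel) m₁ (m₂ ⊔ M.valueSigma X S)
      (M.valueSigma X S) :=
    ((hci.symm hm₁le hm₂le hσ).mono_right le_sup_left).symm hm₂le hm₁le hσ
  have hYm : Measurable[m₂ ⊔ M.valueSigma X S] fun z => M.switchValue X z Y :=
    M.measurable_solve_act_of_mem (mΩ := m₂ ⊔ M.valueSigma X S) (F := F₂) (S := S)
      (K := Set.univ) (fun _ _ _ _ => trivial) (fun a ha b hb => hF₂ a ha b (.inl hb))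
      (fun h => absurd h (Set.disjoint_left.1 hdisj hXF))
      (fun a ha => (M.measurable_valueSigma X ha.1).mono le_sup_right le_rfl)
      (fun a ha j hj => (M.measurable_exo_of_mem (Set.mem_biUnion ha hj)).mono le_sup_left le_rfl)
      (.inl hYF) trivial
  refine Measure.ext fun B hB => ?_
  set F : (∀ a, D a) → ℝ≥0∞ := fun v => B.indicator 1 (Set.domRestrict {Y} v)
  have hres : ∀ A : Set V, Measurable (A.domRestrict : (∀ a, D a) → ∀ a : A, D a) :=
    Set.measurable_restrict
  have hind : Measurable (B.indicator (1 : (∀ a : ({Y} : Set V), D a) → ℝ≥0∞)) :=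
    measurable_one.indicator hB
  have hF : Measurable F := hind.comp (hres {Y})
  have hFm : Measurable[m₂ ⊔ M.valueSigma X S] fun z => F (M.switchValue X z) := by
    refine hind.comp (@measurable_pi_lambda _ _ _ (m₂ ⊔ M.valueSigma X S) _ _ fun b => ?_)
    obtain ⟨b, rfl⟩ := b
    exact hYm
  -- `g` is a conditional expectation given `S` that serves both positions of the switch.
  obtain ⟨g, hg, hgt⟩ := hci' _ hFm (by
    refine ne_top_of_le_ne_top (measure_ne_top (M.switchLaw π.kernel) Set.univ) ?_
    rw [← lintegral_one]
    refine lintegral_mono fun z => ?_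
    exact Set.indicator_le_self' (fun _ _ => zero_le_one) _)
  -- As a function of the values of `S`, it has the same integral under both laws.
  rw [valueSigma_eq_comap] at hg
  obtain ⟨k, hk, rfl⟩ := hg.exists_eq_measurable_comp
  have hswitch : ∀ i, MeasurableSet[m₁ ⊔ M.valueSigma X S]
      {z : (Bool × M.Exo) × D X | z.1.1 = i} := fun i =>
    (le_sup_of_le_left (le_sup_of_le_left le_sup_left) :
      MeasurableSpace.comap _ _ ≤ m₁ ⊔ M.valueSigma X S) _ ⟨{i}, measurableSet_singleton i, rfl⟩
  have hlaw : ∀ μ : Measure (∀ a, D a), marginal μ {Y} B = ∫⁻ v, F v ∂μ := by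
    intro μ
    rw [← lintegral_indicator_one hB, marginal, lintegral_map hind (hres _)]
  have hk' : Measurable fun v : ∀ a, D a => k (S.domRestrict v) := hk.comp (hres S)
  rw [hlaw, hlaw, ← M.setLIntegral_switchLaw_true π.kernel hF,
    ← M.setLIntegral_switchLaw_false π.kernel hF, hgt _ (hswitch true), hgt _ (hswitch false)]
  have e1 := M.setLIntegral_switchLaw_true π.kernel hk'
  have e2 := M.setLIntegral_switchLaw_false π.kernel hk'
  refine e1.trans (Eq.trans ?_ e2.symm)
  rw [← lintegral_map hk (hres S), ← lintegral_map hk (hres S)]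
  exact congrArg (fun μ => ∫⁻ y, k y ∂μ) h

end Separation

/-! ### Policies in a subspace and marginals -/

section Lift

variable {V : Type u} {D : V → Type v} [∀ a, MeasurableSpace (D a)]
  {G : CausalDiagram V} {X : V}

theorem doLaw_lift [Finite V] (M : SCM.{u, v, w} V D) {Pol' Pol : PolicySpace G X}
    (h : Pol'.IsSubspace Pol) (π : Policy Pol' D) :
    M.doLaw (π.lift h).kernel = M.doLaw π.kernel := rfl

theorem map_domRestrict₂_marginal (μ : Measure (∀ a, D a)) {A B : Set V} (h : A ⊆ B) :
    (marginal μ B).map (Set.domRestrict₂ h) = marginal μ A := by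
  unfold marginal
  rw [Measure.map_map (Set.measurable_restrict₂ h) (Set.measurable_restrict B)]
  rfl

end Lift

end CausalImitation

open CausalImitation
theorem mainTheorem5 {V : Type u} [Finite V] {D : V → Type v} [∀ a, MeasurableSpace (D a)]
    (G : CausalDiagram V) (X Y : V)
    (hX : X ∈ G.obs) (hY : Y ∉ G.obs) (hXY : Y ∈ G.descendants X)
    (R : Set (Measure (∀ a : G.obs, D a)))
    (Pol Pol' : PolicySpace G X) (P : Measure (∀ a : G.obs, D a)) (S : Set V)
    (hS : IsInstrument.{u, v, w} D R Y Pol S Pol')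
    (M : POSCM.{u, v, w} V D) (hM : M ∈ modelClassOf.{u, v, w} G R P) (π : Policy Pol' D)
    (hπ : marginal (M.doLaw π.kernel) S = P.map (Set.domRestrict₂ hS.surrogate.1)) :
    PImitable.{u, v, w} R Pol P {Y} ∧
      IsImitating.{u, v, w} R P {Y} (π.lift hS.subspace) := by
  have himit : IsImitating.{u, v, w} R P {Y} (π.lift hS.subspace) := by
    intro M' hM'
    rw [doLaw_lift]
    have h1 : marginal (M'.doLaw π.kernel) S = marginal M'.law S := by
      rw [hS.identifiable M' hM'.1 M hM.1 (hM'.2.trans hM.2.symm) π, hπ, ← hM'.2,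
        map_domRestrict₂_marginal]
    obtain ⟨⟨rfl, -⟩, -⟩ := hM'
    exact marginal_doLaw_eq_of_surrogate π hXY hS.surrogate h1
  exact ⟨⟨_, himit⟩, himit⟩
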